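/- Let $G=(V,E)$ be a finite tree (a connected acyclic graph, $|V|\ge 1$), let every node $i\in V$ carry a variable with a finite set of values, and let $d_i$ be the degree of $i$ in $G$. For numbers $\nu_i(z_i)$ ($i\in V$) and $\nu_{ij}(z_i,z_j)$ ($ij\in E$) put $$I(z;\nu)=\Big[\sum_{i\in V}(1-d_i)\,\nu_i(z_i)+\sum_{ij\in E}\nu_{ij}(z_i,z_j)\Big]_+,\qquad [t]_+=\max\{t,0\}.$$ Consider either of the following two settings. (a) (Labels are nodes of the tree.) $V$ is split into label nodes and feature nodes (the label may be multivariate). $\boldsymbol\mu$ consists of singleton marginals $\mu_i(z_i)$, $i\in V$, and pairwise marginals $\mu_{ij}(z_i,z_j)$, $ij\in E$. $\mathcal P(\boldsymbol\mu)$ is the set of all probability distributions over all variables that have the marginals $\boldsymbol\mu$. An assignment is written $(x,y)$, with $x$ the values of the features and $y$ the values of the labels, and $I(x,y;\boldsymbol\mu)$ is $I$ evaluated at this assignment. (b) (Single label.) The nodes of $G$ are the features, and there is one further label variable with a finite set of values. $\boldsymbol\mu$ consists of marginals $\mu_i(x_i,y)$, $i\in V$, and $\mu_{ij}(x_i,x_j,y)$,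 $ij\in E$. $\mathcal P(\boldsymbol\mu)$ is the set of all joint distributions of the features and the label that have these marginals, and $I(x,y;\boldsymbol\mu)=I(x;\boldsymbol\mu(\cdot,y))$. Assume $\mathcal P(\boldsymbol\mu)\neq\emptyset$ and fix an assignment $(x,y)$. Then $$\min_{p\in\mathcal P(\boldsymbol\mu)}p(x,y)=I(x,y;\boldsymbol\mu),$$ the maximum $M=\max_{p\in\mathcal P(\boldsymbol\mu)}\sum_{\bar y\ne y}p(x,\bar y)$ is attained, and, if $I(x,y;\boldsymbol\mu)+M>0$, $$\min_{p\in\mathcal P(\boldsymbol\mu),\;p(x)>0}p(y\mid x)=\frac{I(x,y;\boldsymbol\mu)}{I(x,y;\boldsymbol\mu)+M},$$ the minimum being attained. In the degenerate case $I(x,y;\boldsymbol\mu)=M=0$, where the quotient is undefined, the minimum on the left equals $1$ provided that some $p\in\mathcal P(\boldsymbol\mu)$ has $p(x)>0$. -/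

import Mathlib

noncomputable section

namespace RobustCond

/-- The probability of the event `A` under the mass function `p` on a finite set of outcomes. -/
def prob {Ω : Type*} [Fintype Ω] (p : Ω → ℝ) (A : Set Ω) : ℝ :=
  ∑ z, A.indicator p z

/-- The conditional probability of `A` given `B`. It is used only where `0 < prob p B`. -/
def condProb {Ω : Type*} [Fintype Ω] (p : Ω → ℝ) (A B : Set Ω) : ℝ :=
  prob p (A ∩ B) / prob p B

/-- The values taken by `p(A)` as `p` ranges over `P`. -/
def probValues {Ω : Type*} [Fintype Ω] (P : Set (Ω → ℝ)) (A : Set Ω) : Set ℝ :=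
  {r | ∃ p ∈ P, prob p A = r}

/-- The values taken by `p(A | B)` as `p` ranges over the members of `P` for which this
conditional probability is defined. -/
def condProbValues {Ω : Type*} [Fintype Ω] (P : Set (Ω → ℝ)) (A B : Set Ω) : Set ℝ :=
  {r | ∃ p ∈ P, 0 < prob p B ∧ condProb p A B = r}

/-- A vector of singleton and pairwise marginals over the graph `G`: a number `μ_i(a)` for every
node `i` and value `a` of it, and a number `μ_e(a)` for every edge `e = ij` of `G` and every
assignment `a = (a_i, a_j)` of values to its two endpoints. -/
structure PairMarginals {V : Type*} (G : SimpleGraph V) (S : V → Type*) where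
  node : (i : V) → S i → ℝ
  edge : (e : G.edgeSet) → ((i : {i : V // i ∈ (e : Sym2 V)}) → S i) → ℝ

variable {V : Type*} {G : SimpleGraph V} {S : V → Type*}

/-- The nonnegative part of `∑_i (1 - d_i) μ_i(x_i) + ∑_{ij ∈ E} μ_ij(x_i, x_j)`. -/
def PairMarginals.I [Fintype V] [DecidableEq V] [DecidableRel G.Adj]
    (μ : PairMarginals G S) (x : (i : V) → S i) : ℝ :=
  max (∑ i, (1 - (G.degree i : ℝ)) * μ.node i (x i) + ∑ e : G.edgeSet, μ.edge e (fun i => x i)) 0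

/-- The function `q` on assignments (not required to have total mass one) has the
singleton and pairwise marginals `μ`. -/
def PairMarginals.IsMarginalsOf [Fintype V] [DecidableEq V] [∀ i, Fintype (S i)]
    (μ : PairMarginals G S) (q : ((i : V) → S i) → ℝ) : Prop :=
  (∀ (i : V) (a : S i), prob q {z | z i = a} = μ.node i a) ∧
  (∀ (e : G.edgeSet) (a : (i : {i : V // i ∈ (e : Sym2 V)}) → S i),
    prob q {z | ∀ i : {i : V // i ∈ (e : Sym2 V)}, z i = a i} = μ.edge e a)

/-- `P(μ)` when all variables (features and labels alike) are nodes of the graph: the probability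
distributions over all variables whose marginals are `μ`. -/
def PairMarginals.distributions [Fintype V] [DecidableEq V] [∀ i, Fintype (S i)]
    (μ : PairMarginals G S) : Set (((i : V) → S i) → ℝ) :=
  {p | p ∈ stdSimplex ℝ ((i : V) → S i) ∧ μ.IsMarginalsOf p}

/-- `P(μ)` for a single label with values in `L`, when the nodes of the graph are the features and
the given marginals are `μ_i(x_i, y)` and `μ_ij(x_i, x_j, y)`, written here as `(μ y)_i(x_i)` and
`(μ y)_ij(x_i, x_j)`. -/
def labelledDistributions [Fintype V] [DecidableEq V] [∀ i, Fintype (S i)] {L : Type*} [Fintype L]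
    (μ : L → PairMarginals G S) : Set (((i : V) → S i) × L → ℝ) :=
  {p | p ∈ stdSimplex ℝ (((i : V) → S i) × L) ∧ ∀ y, (μ y).IsMarginalsOf (fun z => p (z, y))}

/-- The event that the variables indexed by `A` take the values prescribed by `x`. -/
def agreeOn (A : Set V) (x : (i : V) → S i) : Set ((i : V) → S i) :=
  {z | ∀ i ∈ A, z i = x i}

end RobustCond

end

open Finset

/-! ### Counting vertices and edges in trees. -/

namespace SimpleGraph

variable {V : Type*} [Fintype V] {G : SimpleGraph V}

/-! The sum inside `I` is the integral, against any `q` with marginals `μ`, of an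
inclusion-exclusion weight. On a tree this weight at `z` is one minus the number of components of
the set where `z` differs from `x`: it is 1 at `x`, at most 0 elsewhere, and 0 when that set is
connected. Hence `q x ≥ I` (`I_le`), with equality if `q x = 0` or if every other `z` in the support
differs from `x` on a connected set (`eq_I_of_connected`).

If some such set is disconnected, exchanging `x` and `z` on one component lowers `q x`, keeps the
marginals, and does not decrease the mass of the other assignments with the same features
(`exists_lt_of_not_connected`). So minimizing `q x` among the maximizers of that mass gives a common
optimum. Since `a / (a + b)` increases in `a` and decreases in `b`, it also minimizes the
conditional probability. With a single label the slices decouple. -/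

theorem IsAcyclic.card_edgeFinset_add_one_le [Nonempty V] [Fintype G.edgeSet]
    (hG : G.IsAcyclic) : #G.edgeFinset + 1 ≤ Fintype.card V := by
  classical
  -- A forest extends to a spanning tree of the complete graph.
  obtain ⟨T, hGT, -, hT⟩ :=
    (connected_top (V := V)).exists_isTree_le_of_le_of_isAcyclic le_top hG
  rw [← hT.card_edgeFinset]
  exact Nat.add_le_add_right (card_le_card (edgeFinset_subset_edgeFinset.2 hGT)) 1

variable [DecidableEq V] [DecidableRel G.Adj]

theorem card_filter_edgeFinset_eq_card_induce (P : V → Prop) [DecidablePred P] :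
    #{e ∈ G.edgeFinset | ∀ i ∈ e, P i} = #(G.induce {i | P i}).edgeFinset := by
  rw [← card_map (Function.Embedding.subtype _).sym2Map, map_edgeFinset_induce]
  congr 1
  ext e
  simp [Finset.mem_sym2_iff]

theorem sum_edge_incidence (P : V → Prop) [DecidablePred P] :
    ∑ i, (G.degree i : ℝ) * (if P i then 1 else 0) =
      ∑ e ∈ G.edgeFinset, (#{i | i ∈ e ∧ P i} : ℝ) := by
  have h (i : V) : (G.degree i : ℝ) = ∑ e ∈ G.edgeFinset, if i ∈ e then (1 : ℝ) else 0 := by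
    rw [← card_incidenceFinset_eq_degree, incidenceFinset_eq_filter, sum_boole]
  simp_rw [h, sum_mul]
  rw [sum_comm]
  refine sum_congr rfl fun e _ => ?_
  rw [← sum_boole]
  refine sum_congr rfl fun i _ => ?_
  by_cases h1 : i ∈ e <;> by_cases h2 : P i <;> simp [h1, h2]

/-- Inclusion-exclusion over the edges meeting `{i | P i}`. -/
theorem sum_one_sub_degree_add_edges (P : V → Prop) [DecidablePred P] :
    ∑ i, (1 - (G.degree i : ℝ)) * (if P i then 1 else 0) +
        ∑ e ∈ G.edgeFinset, (if ∀ i ∈ e, P i then (1 : ℝ) else 0) =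
      #{i | P i} - #G.edgeFinset + #{e ∈ G.edgeFinset | ∀ i ∈ e, ¬ P i} := by
  -- An edge has 0, 1 or 2 endpoints in `P`; the last indicator corrects the count minus one in the
  -- case 0.
  have key : ∀ e ∈ G.edgeFinset, (if ∀ i ∈ e, P i then (1 : ℝ) else 0) =
      (#{i | i ∈ e ∧ P i} : ℝ) - 1 + if ∀ i ∈ e, ¬ P i then (1 : ℝ) else 0 := by
    intro e he
    induction e with
    | _ a b =>
      have hab : a ≠ b := (mem_edgeFinset.1 he : G.Adj a b).ne
      have hs : ({i | i ∈ s(a, b) ∧ P i} : Finset V) = ({a, b} : Finset V).filter P := by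
        ext; simp
      rw [hs, filter_insert, filter_singleton]
      by_cases ha : P a <;> by_cases hb : P b <;> simp [ha, hb, hab]
      norm_num
  simp_rw [sub_mul, sum_sub_distrib, sum_edge_incidence, sum_congr rfl key, sum_add_distrib,
    sum_sub_distrib, one_mul, sum_boole]
  simp
  ring

/-- In a tree, the inclusion-exclusion weight of a vertex set is governed by its complement. -/
theorem IsTree.sum_one_sub_degree_add_edges (hG : G.IsTree) (P : V → Prop) [DecidablePred P] :
    ∑ i, (1 - (G.degree i : ℝ)) * (if P i then 1 else 0) +
        ∑ e ∈ G.edgeFinset, (if ∀ i ∈ e, P i then (1 : ℝ) else 0) =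
      1 + #(G.induce {i | ¬ P i}).edgeFinset - Fintype.card {i | ¬ P i} := by
  rw [SimpleGraph.sum_one_sub_degree_add_edges, card_filter_edgeFinset_eq_card_induce]
  have h1 : (#G.edgeFinset : ℝ) + 1 = Fintype.card V := mod_cast hG.card_edgeFinset
  have h2 : (#{i | P i} : ℝ) + #{i | ¬ P i} = Fintype.card V :=
    mod_cast card_filter_add_card_filter_not (s := univ) P
  have h3 : (Fintype.card {i | ¬ P i} : ℝ) = #{i | ¬ P i} := by
    rw [← Set.toFinset_card]; simp
  linarith

theorem IsTree.sum_one_sub_degree_add_edges_nonpos (hG : G.IsTree) (P : V → Prop)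
    [DecidablePred P] (hP : ∃ i, ¬ P i) :
    ∑ i, (1 - (G.degree i : ℝ)) * (if P i then 1 else 0) +
        ∑ e ∈ G.edgeFinset, (if ∀ i ∈ e, P i then (1 : ℝ) else 0) ≤ 0 := by
  rw [hG.sum_one_sub_degree_add_edges]
  have : Nonempty {i | ¬ P i} := hP.elim fun i h => ⟨⟨i, h⟩⟩
  have h : (_ : ℝ) ≤ _ := Nat.cast_le.2
    (hG.isAcyclic.induce {i | ¬ P i}).card_edgeFinset_add_one_le
  push_cast at h
  linarith

theorem IsTree.sum_one_sub_degree_add_edges_eq_zero (hG : G.IsTree) (P : V → Prop)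
    [DecidablePred P] (hP : (G.induce {i | ¬ P i}).Connected) :
    ∑ i, (1 - (G.degree i : ℝ)) * (if P i then 1 else 0) +
        ∑ e ∈ G.edgeFinset, (if ∀ i ∈ e, P i then (1 : ℝ) else 0) = 0 := by
  rw [hG.sum_one_sub_degree_add_edges]
  have h : ((_ : ℕ) : ℝ) = _ := congrArg Nat.cast
    (IsTree.card_edgeFinset (G := G.induce {i | ¬ P i}) ⟨hP, hG.isAcyclic.induce _⟩)
  push_cast at h
  linarith

/-- A disconnected induced subgraph has a component missing some vertex. -/
theorem exists_closed_subset_of_not_connected_induce {V : Type*} {G : SimpleGraph V}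
    {D : Set V} (hD : D.Nonempty) (h : ¬ (G.induce D).Connected) :
    ∃ s ⊆ D, s.Nonempty ∧ (D \ s).Nonempty ∧
      ∀ u v, G.Adj u v → u ∈ s → v ∈ D → v ∈ s := by
  have : Nonempty D := hD.to_subtype
  have h' : ¬ (G.induce D).Preconnected := fun h' => h ⟨h'⟩
  simp only [Preconnected, not_forall] at h'
  obtain ⟨a, b, hab⟩ := h'
  refine ⟨Subtype.val '' {v | (G.induce D).Reachable a v}, by simp, ⟨a, a, .refl _, rfl⟩,
    ⟨b, b.2, ?_⟩, ?_⟩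
  · rintro ⟨c, hc, hcb⟩
    exact hab (Subtype.ext hcb ▸ hc)
  · rintro _ v huv ⟨u, hu, rfl⟩ hv
    exact ⟨⟨v, hv⟩, Reachable.trans hu (Adj.reachable (by simpa using huv)), rfl⟩

end SimpleGraph

namespace RobustCond

/-! ### Finite probabilities and the reduction to a common optimum. -/

section prob

variable {Ω : Type*} [Fintype Ω] {p q : Ω → ℝ} {A B : Set Ω}

theorem prob_add (p q : Ω → ℝ) (A : Set Ω) : prob (p + q) A = prob p A + prob q A := by
  simp [prob, Set.indicator_add', sum_add_distrib]

theorem prob_sub (p q : Ω → ℝ) (A : Set Ω) : prob (p - q) A = prob p A - prob q A := by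
  simp [prob, Set.indicator_sub', sum_sub_distrib]

theorem prob_smul (c : ℝ) (p : Ω → ℝ) (A : Set Ω) : prob (c • p) A = c * prob p A := by
  simp only [prob, mul_sum]
  refine sum_congr rfl fun z _ => ?_
  by_cases hz : z ∈ A <;> simp [hz]

theorem prob_single [DecidableEq Ω] (x : Ω) (A : Set Ω) :
    prob (Pi.single x 1) A = A.indicator 1 x := by
  rw [prob, sum_eq_single x]
  · by_cases hx : x ∈ A <;> simp [hx]
  · intro z _ hz
    by_cases hzA : z ∈ A <;> simp [hzA, hz]
  · simp

theorem prob_singleton (p : Ω → ℝ) (x : Ω) : prob p {x} = p x := by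
  rw [prob, sum_eq_single x] <;> simp +contextual

theorem prob_nonneg (hp : ∀ z, 0 ≤ p z) (A : Set Ω) : 0 ≤ prob p A :=
  sum_nonneg fun z _ => Set.indicator_nonneg (fun z _ => hp z) z

theorem prob_mono (hp : ∀ z, 0 ≤ p z) (h : A ⊆ B) : prob p A ≤ prob p B :=
  sum_le_sum fun z _ => Set.indicator_le_indicator_of_subset h hp z

theorem prob_inter_add_sdiff (p : Ω → ℝ) (A B : Set Ω) :
    prob p (A ∩ B) + prob p (B \ A) = prob p B := by
  simp only [prob, ← sum_add_distrib]
  refine sum_congr rfl fun z _ => ?_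
  by_cases hA : z ∈ A <;> by_cases hB : z ∈ B <;> simp [hA, hB]

theorem continuous_prob (A : Set Ω) : Continuous fun p : Ω → ℝ => prob p A := by
  refine continuous_finsetSum _ fun z _ => ?_
  by_cases hz : z ∈ A
  · simpa [hz] using continuous_apply z
  · simpa [hz] using continuous_const

/-- If a single `p` minimizes the probability of `A ∩ B` and maximizes that of `B \ A`, then it
minimizes the conditional probability of `A` given `B`. -/
theorem isLeast_condProbValues_of_common_optimum {P : Set (Ω → ℝ)} (hP : ∀ p ∈ P, ∀ z, 0 ≤ p z)
    (hp : p ∈ P) (hmin : ∀ q ∈ P, prob p (A ∩ B) ≤ prob q (A ∩ B))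
    (hmax : ∀ q ∈ P, prob q (B \ A) ≤ prob p (B \ A)) :
    IsLeast (probValues P (A ∩ B)) (prob p (A ∩ B)) ∧
    ∃ M : ℝ, IsGreatest (probValues P (B \ A)) M ∧
      (0 < prob p (A ∩ B) + M →
        IsLeast (condProbValues P A B) (prob p (A ∩ B) / (prob p (A ∩ B) + M))) ∧
      (prob p (A ∩ B) + M = 0 → (∃ q ∈ P, 0 < prob q B) →
        IsLeast (condProbValues P A B) 1) := by
  refine ⟨⟨⟨p, hp, rfl⟩, ?_⟩, prob p (B \ A), ⟨⟨p, hp, rfl⟩, ?_⟩, ?_, ?_⟩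
  · rintro _ ⟨q, hq, rfl⟩
    exact hmin q hq
  · rintro _ ⟨q, hq, rfl⟩
    exact hmax q hq
  · intro hpos
    refine ⟨⟨p, hp, ?_, ?_⟩, ?_⟩
    · rwa [← prob_inter_add_sdiff p A B]
    · rw [condProb, prob_inter_add_sdiff]
    · rintro _ ⟨q, hq, hqB, rfl⟩
      have h1 := hmin q hq
      have h2 := hmax q hq
      have h3 := prob_nonneg (hP p hp) (A ∩ B)
      have h4 := prob_nonneg (hP q hq) (B \ A)
      rw [condProb, div_le_div_iff₀ hpos hqB, ← prob_inter_add_sdiff q A B, mul_add, mul_add,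
        mul_comm (prob q (A ∩ B)) (prob p (A ∩ B))]
      have := mul_le_mul h1 h2 h4 (h3.trans h1)
      linarith
  · intro hzero
    have hA := prob_nonneg (hP p hp) (A ∩ B)
    -- The maximum over `B \ A` is now at most 0, so every `q` puts all its mass on `B` inside `A`.
    have key : ∀ q ∈ P, 0 < prob q B → condProb q A B = 1 := by
      intro q hq hqB
      have h2 := hmax q hq
      have h4 := prob_nonneg (hP q hq) (B \ A)
      have h5 := prob_inter_add_sdiff q A B
      rw [condProb, div_eq_one_iff_eq hqB.ne']
      linarith
    rintro ⟨q, hq, hqB⟩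
    refine ⟨⟨q, hq, hqB, key q hq hqB⟩, ?_⟩
    rintro _ ⟨r, hr, hrB, rfl⟩
    exact (key r hr hrB).ge

end prob

variable {V : Type*} [Fintype V] [DecidableEq V] {G : SimpleGraph V} {S : V → Type*}

/-! ### The agreement weight and the lower bound. -/

section weight

variable [DecidableRel G.Adj]

open Classical in
/-- The inclusion-exclusion weight of the set of nodes on which `z` agrees with `x`. -/
noncomputable def agreementWeight (G : SimpleGraph V) [DecidableRel G.Adj] (x z : (i : V) → S i) : ℝ :=
  ∑ i, (1 - (G.degree i : ℝ)) * (if z i = x i then 1 else 0) +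
    ∑ e ∈ G.edgeFinset, (if ∀ i ∈ e, z i = x i then (1 : ℝ) else 0)

theorem agreementWeight_self (hG : G.IsTree) (x : (i : V) → S i) :
    agreementWeight G x x = 1 := by
  classical
  have h : (#G.edgeFinset : ℝ) + 1 = Fintype.card V := mod_cast hG.card_edgeFinset
  have := SimpleGraph.sum_one_sub_degree_add_edges (G := G) (fun i => x i = x i)
  rw [filter_false_of_mem (s := G.edgeFinset)] at this
  · rw [agreementWeight, this]
    simp
    linarith
  · intro e _
    induction e with
    | _ a b => exact fun h => h a (by simp) rfl

theorem agreementWeight_nonpos (hG : G.IsTree) {x z : (i : V) → S i} (h : z ≠ x) :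
    agreementWeight G x z ≤ 0 := by
  classical
  exact hG.sum_one_sub_degree_add_edges_nonpos (fun i => z i = x i) (Function.ne_iff.1 h)

theorem agreementWeight_eq_zero (hG : G.IsTree) {x z : (i : V) → S i}
    (h : (G.induce {i | z i ≠ x i}).Connected) : agreementWeight G x z = 0 := by
  classical
  exact hG.sum_one_sub_degree_add_edges_eq_zero (fun i => z i = x i) h

end weight

variable [∀ i, Fintype (S i)]

namespace PairMarginals

variable {μ : PairMarginals G S} {q : ((i : V) → S i) → ℝ}

/-- The nonnegative functions with marginals `μ`. -/
def measures (μ : PairMarginals G S) : Set (((i : V) → S i) → ℝ) :=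
  {q | (∀ z, 0 ≤ q z) ∧ μ.IsMarginalsOf q}

/-- Any one node's marginals fix the total mass, so normalization can be dropped from the
optimization. -/
theorem IsMarginalsOf.sum_eq (hq : μ.IsMarginalsOf q) (i : V) :
    ∑ z, q z = ∑ a, μ.node i a := by
  simp_rw [← hq.1 i, prob]
  rw [sum_comm]
  refine sum_congr rfl fun z _ => ?_
  rw [sum_eq_single (z i)] <;> simp +contextual [eq_comm]

theorem isClosed_isMarginalsOf (μ : PairMarginals G S) : IsClosed {q | μ.IsMarginalsOf q} := by
  simp only [IsMarginalsOf, Set.ofPred_and, Set.ofPred_forall]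
  exact (isClosed_iInter fun i => isClosed_iInter fun a =>
    isClosed_eq (continuous_prob _) continuous_const).inter
    (isClosed_iInter fun e => isClosed_iInter fun a =>
    isClosed_eq (continuous_prob _) continuous_const)

theorem isCompact_measures [Nonempty V] (μ : PairMarginals G S) : IsCompact μ.measures := by
  obtain ⟨i⟩ := ‹Nonempty V›
  have hK : IsCompact (Set.univ.pi fun z : (i : V) → S i => Set.Icc 0 (μ.node i (z i))) :=
    isCompact_univ_pi fun z => isCompact_Icc
  refine hK.of_isClosed_subset ?_ fun q hq z _ => ⟨hq.1 z, ?_⟩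
  · simp only [measures, Set.ofPred_and, Set.ofPred_forall]
    exact (isClosed_iInter fun z => isClosed_le continuous_const (continuous_apply z)).inter
      μ.isClosed_isMarginalsOf
  · rw [← hq.2.1 i, ← prob_singleton q z]
    exact prob_mono hq.1 (by simp)

section weight

variable [DecidableRel G.Adj]

theorem IsMarginalsOf.sum_mul_agreementWeight (hq : μ.IsMarginalsOf q) (x : (i : V) → S i) :
    ∑ z, q z * agreementWeight G x z =
      ∑ i, (1 - (G.degree i : ℝ)) * μ.node i (x i) +
        ∑ e : G.edgeSet, μ.edge e (fun i => x i) := by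
  classical
  have hE : ∀ f : Sym2 V → ℝ, ∑ e ∈ G.edgeFinset, f e = ∑ e : G.edgeSet, f e := fun f =>
    sum_subtype _ (fun e => by simp) f
  simp_rw [agreementWeight, hE, mul_add, sum_add_distrib, mul_sum, ← hq.1, ← hq.2, prob, mul_sum]
  rw [sum_comm, sum_comm (s := univ (α := (i : V) → S i)) (t := univ (α := G.edgeSet))]
  congr 1
  · refine sum_congr rfl fun i _ => sum_congr rfl fun z _ => ?_
    by_cases h : z i = x i <;> simp [h, mul_comm]
  · refine sum_congr rfl fun e _ => sum_congr rfl fun z _ => ?_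
    simp [Set.indicator_apply]

theorem I_le (hG : G.IsTree) (hq : q ∈ μ.measures) (x : (i : V) → S i) : μ.I x ≤ q x := by
  refine max_le ?_ (hq.1 x)
  rw [← hq.2.sum_mul_agreementWeight, ← mul_one (q x), ← agreementWeight_self hG x]
  classical
  rw [← add_sum_erase _ _ (mem_univ x), add_le_iff_nonpos_right]
  exact sum_nonpos fun z hz => mul_nonpos_of_nonneg_of_nonpos (hq.1 z)
    (agreementWeight_nonpos hG (ne_of_mem_erase hz))

/-- Complementary slackness: only `x` contributes to the integral of the weight. -/
theorem eq_I_of_connected (hG : G.IsTree) (hq : q ∈ μ.measures) (x : (i : V) → S i)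
    (h : ∀ z, z ≠ x → 0 < q z → (G.induce {i | z i ≠ x i}).Connected) : q x = μ.I x := by
  refine le_antisymm ?_ (I_le hG hq x)
  refine le_trans (le_of_eq ?_) (le_max_left _ _)
  rw [← hq.2.sum_mul_agreementWeight, sum_eq_single x]
  · rw [agreementWeight_self hG, mul_one]
  · intro z _ hz
    rcases (hq.1 z).eq_or_lt with h0 | h0
    · rw [← h0, zero_mul]
    · rw [agreementWeight_eq_zero hG (h z hz h0), mul_zero]
  · simp

theorem eq_I_of_eq_zero (hG : G.IsTree) (hq : q ∈ μ.measures) {x : (i : V) → S i}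
    (h : q x = 0) : q x = μ.I x :=
  le_antisymm (h ▸ le_max_right _ _) (I_le hG hq x)

end weight

end PairMarginals

end RobustCond

namespace RobustCond

/-! ### The exchange argument. -/

section swap

variable {V : Type*} {S : V → Type*}

/-- An event depending only on coordinates on which a pair of assignments is kept or exchanged as
a whole holds equally often before and after the exchange. -/
theorem indicator_add_indicator_of_swap {x z x' z' : (i : V) → S i} {U : Set V}
    (h : (∀ i ∈ U, x' i = z i ∧ z' i = x i) ∨ (∀ i ∈ U, x' i = x i ∧ z' i = z i))
    {A : Set ((i : V) → S i)}
    (hA : ∀ f g : (i : V) → S i, (∀ i ∈ U, f i = g i) → (f ∈ A ↔ g ∈ A)) :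
    A.indicator (1 : ((i : V) → S i) → ℝ) x' + A.indicator 1 z' = A.indicator 1 x + A.indicator 1 z := by
  classical
  simp only [Set.indicator_apply, Pi.one_apply]
  rcases h with h | h
  · rw [hA x' z fun i hi => (h i hi).1, hA z' x fun i hi => (h i hi).2, add_comm]
  · rw [hA x' x fun i hi => (h i hi).1, hA z' z fun i hi => (h i hi).2]

end swap

variable {V : Type*} [Fintype V] [DecidableEq V] {G : SimpleGraph V} {S : V → Type*}
  [∀ i, Fintype (S i)]

namespace PairMarginals

variable {μ : PairMarginals G S} {q : ((i : V) → S i) → ℝ}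

theorem IsMarginalsOf.add_of_null {r : ((i : V) → S i) → ℝ} (hq : μ.IsMarginalsOf q)
    (hnode : ∀ i (a : S i), prob r {z | z i = a} = 0)
    (hedge : ∀ (e : G.edgeSet) (a : (i : {i : V // i ∈ (e : Sym2 V)}) → S i),
      prob r {z | ∀ i : {i : V // i ∈ (e : Sym2 V)}, z i = a i} = 0) :
    μ.IsMarginalsOf (q + r) :=
  ⟨fun i a => by rw [prob_add, hnode, add_zero, hq.1],
    fun e a => by rw [prob_add, hedge, add_zero, hq.2]⟩

/-- If `x` and `z` have positive mass and differ on a disconnected set of nodes, mass can be moved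
away from `x` by exchanging the values of `x` and `z` on a component of that set. -/
theorem exists_lt_of_not_connected (hq : q ∈ μ.measures) {x z : (i : V) → S i} (hx : 0 < q x)
    (hz : 0 < q z) (hzx : z ≠ x) (h : ¬ (G.induce {i | z i ≠ x i}).Connected) :
    ∃ q' ∈ μ.measures, q' x < q x ∧
      ∀ F : Set V, prob q (agreeOn F x \ {x}) ≤ prob q' (agreeOn F x \ {x}) := by
  classical
  obtain ⟨s, hsD, ⟨a, has⟩, ⟨b, hbD, hbs⟩, hs⟩ :=
    SimpleGraph.exists_closed_subset_of_not_connected_induce (Function.ne_iff.1 hzx) h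
  set x' := s.piecewise z x with hx'
  set z' := s.piecewise x z with hz'
  have hx'x : x' ≠ x := fun h => hsD has (by simpa [hx', has] using congrFun h a)
  have hz'x : z' ≠ x := fun h => hbD (by simpa [hz', hbs] using congrFun h b)
  -- The largest amount that can be removed from both `x` and `z`.
  set ε := min (q x) (q z) with hε
  have hε0 : 0 < ε := lt_min hx hz
  set r : ((i : V) → S i) → ℝ :=
    ε • (Pi.single x' 1 + Pi.single z' 1 - (Pi.single x 1 + Pi.single z 1)) with hr
  have hprob (A : Set ((i : V) → S i)) : prob r A =
      ε * (A.indicator 1 x' + A.indicator 1 z' - (A.indicator 1 x + A.indicator 1 z)) := by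
    simp only [hr, prob_smul, prob_sub, prob_add, prob_single]
  have hnull {U : Set V} {A : Set ((i : V) → S i)}
      (hU : (∀ i ∈ U, x' i = z i ∧ z' i = x i) ∨ (∀ i ∈ U, x' i = x i ∧ z' i = z i))
      (hA : ∀ f g : (i : V) → S i, (∀ i ∈ U, f i = g i) → (f ∈ A ↔ g ∈ A)) : prob r A = 0 := by
    rw [hprob, indicator_add_indicator_of_swap hU hA, sub_self, mul_zero]
  have hin {i : V} (hi : i ∈ s) : x' i = z i ∧ z' i = x i := by simp [hx', hz', hi]
  have hout {i : V} (hi : i ∉ s) : x' i = x i ∧ z' i = z i := by simp [hx', hz', hi]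
  -- An edge leaving the component ends where `x` and `z` agree, so it too may be regarded as
  -- exchanged as a whole.
  have hbdry {u v : V} (huv : G.Adj u v) (hu : u ∈ s) (hv : v ∉ s) :
      x' v = z v ∧ z' v = x v := by
    have : z v = x v := not_not.1 fun hne => hv (hs u v huv hu hne)
    rw [(hout hv).1, (hout hv).2, this]
    exact ⟨rfl, rfl⟩
  refine ⟨q + r, ⟨fun w => ?_, hq.2.add_of_null ?_ ?_⟩, ?_, fun F => ?_⟩
  · have hw := hq.1 w
    have h1 : ε ≤ q x := min_le_left _ _
    have h2 : ε ≤ q z := min_le_right _ _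
    have h3 : 0 ≤ (Pi.single x' 1 : _ → ℝ) w := by
      rw [Pi.single_apply]; split_ifs <;> norm_num
    have h4 : 0 ≤ (Pi.single z' 1 : _ → ℝ) w := by
      rw [Pi.single_apply]; split_ifs <;> norm_num
    have h5 : ε * ((Pi.single x 1 : _ → ℝ) w + (Pi.single z 1 : _ → ℝ) w) ≤ q w := by
      rcases eq_or_ne w x with rfl | hwx
      · simpa [hzx.symm] using h1
      · rcases eq_or_ne w z with rfl | hwz
        · simpa [hzx] using h2
        · simpa [hwx, hwz] using hw
    simp only [hr, Pi.add_apply, Pi.smul_apply, Pi.sub_apply, smul_eq_mul, mul_sub]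
    have := mul_nonneg hε0.le (add_nonneg h3 h4)
    linarith
  · intro i a
    refine hnull (U := {i}) ?_ fun f g hfg => ?_
    · by_cases hi : i ∈ s
      · exact .inl (by simpa using hin hi)
      · exact .inr (by simpa using hout hi)
    · simp [hfg i rfl]
  · rintro ⟨e, he⟩ a
    refine hnull (U := {i | i ∈ e}) ?_ fun f g hfg => ?_
    · clear a
      induction e with
      | _ u v =>
        have huv : G.Adj u v := he
        by_cases hu : u ∈ s <;> by_cases hv : v ∈ s
        · exact .inl (by simpa using ⟨hin hu, hin hv⟩)
        · exact .inl (by simpa using ⟨hin hu, hbdry huv hu hv⟩)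
        · exact .inl (by simpa using ⟨hbdry huv.symm hv hu, hin hv⟩)
        · exact .inr (by simpa using ⟨hout hu, hout hv⟩)
    · exact forall_congr' fun i => by rw [hfg i i.2]
  · have : r x = -ε := by
      simp [hr, hx'x.symm, hz'x.symm, hzx.symm]
    rw [Pi.add_apply, this]
    linarith
  · rw [prob_add, hprob, le_add_iff_nonneg_right]
    refine mul_nonneg hε0.le ?_
    have h1 : (agreeOn F x \ {x}).indicator (1 : ((i : V) → S i) → ℝ) x = 0 := by simp
    -- Mass lost at `z` is regained at `x'`, whose values all come from `x` or `z`; `x` itself is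
    -- not in the event.
    have h2 : (agreeOn F x \ {x}).indicator (1 : ((i : V) → S i) → ℝ) z ≤
        (agreeOn F x \ {x}).indicator 1 x' := by
      by_cases hzF : z ∈ agreeOn F x
      · have hx'F : x' ∈ agreeOn F x := fun i hi => by
          by_cases his : i ∈ s
          · rw [(hin his).1, hzF i hi]
          · exact (hout his).1
        simp [hzF, hzx, hx'F, hx'x]
      · rw [Set.indicator_of_notMem fun h => hzF h.1]
        exact Set.indicator_nonneg (fun _ _ => zero_le_one) _
    have h3 : 0 ≤ (agreeOn F x \ {x}).indicator (1 : ((i : V) → S i) → ℝ) z' :=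
      Set.indicator_nonneg (fun _ _ => zero_le_one) _
    linarith

/-- Minimizing the mass of `x` and maximizing the mass of the other assignments that agree with
`x` on `F` can be achieved simultaneously. -/
theorem exists_common_optimum [DecidableRel G.Adj] (hG : G.IsTree) (hμ : μ.measures.Nonempty)
    (F : Set V) (x : (i : V) → S i) :
    ∃ q ∈ μ.measures, q x = μ.I x ∧
      ∀ r ∈ μ.measures, prob r (agreeOn F x \ {x}) ≤ prob q (agreeOn F x \ {x}) := by
  have := hG.1.nonempty
  obtain ⟨q₀, hq₀, hmax⟩ := μ.isCompact_measures.exists_isMaxOn hμ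
    (continuous_prob (agreeOn F x \ {x})).continuousOn
  -- Lexicographic choice: minimize `q x` over the compact set of maximizers.
  have hK : IsCompact (μ.measures ∩ {q | prob q₀ (agreeOn F x \ {x}) ≤
      prob q (agreeOn F x \ {x})}) :=
    μ.isCompact_measures.inter_right (isClosed_le continuous_const (continuous_prob _))
  obtain ⟨q, ⟨hq, hqmax⟩, hmin⟩ := hK.exists_isMinOn ⟨q₀, hq₀, le_refl (prob q₀ _)⟩
    (continuous_apply x).continuousOn
  refine ⟨q, hq, ?_, fun r hr => (hmax hr).trans hqmax⟩
  rcases (hq.1 x).eq_or_lt with h0 | h0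
  · exact eq_I_of_eq_zero hG hq h0.symm
  · refine eq_I_of_connected hG hq x fun z hzx hz => ?_
    by_contra hcon
    obtain ⟨q', hq', hlt, hle⟩ := exists_lt_of_not_connected hq h0 hz hzx hcon
    exact hlt.not_ge (hmin ⟨hq', le_trans hqmax (hle F)⟩)

theorem mem_distributions_of_mem_measures [Nonempty V] (hμ : μ.distributions.Nonempty)
    (hq : q ∈ μ.measures) : q ∈ μ.distributions := by
  obtain ⟨p, hp, hpμ⟩ := hμ
  obtain ⟨i⟩ := ‹Nonempty V›
  exact ⟨⟨hq.1, by rw [hq.2.sum_eq i, ← hpμ.sum_eq i, hp.2]⟩, hq.2⟩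

end PairMarginals

/-! ### The two settings for labels. -/

theorem agreeOn_inter_agreeOn_compl {V : Type*} {S : V → Type*} (H : Set V)
    (x : (i : V) → S i) : agreeOn H x ∩ agreeOn Hᶜ x = {x} := by
  ext z
  refine ⟨fun h => funext fun i => ?_, ?_⟩
  · by_cases hi : i ∈ H
    exacts [h.1 i hi, h.2 i hi]
  · rintro rfl
    exact ⟨fun _ _ => rfl, fun _ _ => rfl⟩

theorem isCompact_labelledDistributions {L : Type*} [Fintype L] (μ : L → PairMarginals G S) :
    IsCompact (labelledDistributions μ) := by
  refine (isCompact_stdSimplex ℝ _).inter_right (s := stdSimplex ℝ (((i : V) → S i) × L))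
    (t := {p | ∀ y, (μ y).IsMarginalsOf fun z => p (z, y)}) ?_
  simp only [Set.ofPred_forall]
  refine isClosed_iInter fun y => ?_
  have hslice : Continuous fun (p : ((i : V) → S i) × L → ℝ) z => p (z, y) :=
    continuous_pi fun z => continuous_apply (z, y)
  exact (μ y).isClosed_isMarginalsOf.preimage hslice

/-- Replacing the slice at one label by another measure with the same marginals. -/
theorem update_slice_mem_labelledDistributions [Nonempty V] {L : Type*} [Fintype L]
    [DecidableEq L] {μ : L → PairMarginals G S} {p : ((i : V) → S i) × L → ℝ}
    (hp : p ∈ labelledDistributions μ) {y : L} {q : ((i : V) → S i) → ℝ}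
    (hq : q ∈ (μ y).measures) :
    (fun ω => if ω.2 = y then q ω.1 else p ω) ∈ labelledDistributions μ := by
  obtain ⟨i⟩ := ‹Nonempty V›
  have hmarg : ∀ y', (μ y').IsMarginalsOf fun z => if y' = y then q z else p (z, y') := by
    intro y'
    by_cases h : y' = y
    · subst h
      simpa using hq.2
    · simpa [h] using hp.2 y'
  refine ⟨⟨fun ω => ?_, ?_⟩, hmarg⟩
  · dsimp only
    split_ifs
    exacts [hq.1 _, hp.1.1 _]
  · rw [← hp.1.2, Fintype.sum_prod_type_right, Fintype.sum_prod_type_right]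
    exact sum_congr rfl fun y' _ => by rw [(hmarg y').sum_eq i, (hp.2 y').sum_eq i]

end RobustCond

theorem theorem1 {V : Type*} [Fintype V] [DecidableEq V] (G : SimpleGraph V) [DecidableRel G.Adj]
    (hG : G.IsTree) (S : V → Type*) [∀ i, Fintype (S i)] :
    -- Features and (possibly multivariate) labels are nodes of the tree, `H` is the set of labels.
    (∀ (μ : RobustCond.PairMarginals G S), μ.distributions.Nonempty →
      ∀ (H : Set V) (x : (i : V) → S i),
        IsLeast (RobustCond.probValues μ.distributions
          (RobustCond.agreeOn H x ∩ RobustCond.agreeOn Hᶜ x)) (μ.I x) ∧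
        ∃ M : ℝ,
          IsGreatest (RobustCond.probValues μ.distributions
            (RobustCond.agreeOn Hᶜ x \ RobustCond.agreeOn H x)) M ∧
          (0 < μ.I x + M →
            IsLeast (RobustCond.condProbValues μ.distributions
              (RobustCond.agreeOn H x) (RobustCond.agreeOn Hᶜ x)) (μ.I x / (μ.I x + M))) ∧
          (μ.I x + M = 0 →
            (∃ p ∈ μ.distributions, 0 < RobustCond.prob p (RobustCond.agreeOn Hᶜ x)) →
            IsLeast (RobustCond.condProbValues μ.distributions
              (RobustCond.agreeOn H x) (RobustCond.agreeOn Hᶜ x)) 1)) ∧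
    -- The features are the nodes of the tree, and the marginals are joint with a single label.
    (∀ (L : Type*) [Fintype L] (μ : L → RobustCond.PairMarginals G S),
      (RobustCond.labelledDistributions μ).Nonempty →
      ∀ (x : (i : V) → S i) (y : L),
        IsLeast (RobustCond.probValues (RobustCond.labelledDistributions μ)
          ({ω | ω.2 = y} ∩ {ω | ω.1 = x})) ((μ y).I x) ∧
        ∃ M : ℝ,
          IsGreatest (RobustCond.probValues (RobustCond.labelledDistributions μ)
            ({ω | ω.1 = x} \ {ω | ω.2 = y})) M ∧
          (0 < (μ y).I x + M →
            IsLeast (RobustCond.condProbValues (RobustCond.labelledDistributions μ)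
              {ω | ω.2 = y} {ω | ω.1 = x}) ((μ y).I x / ((μ y).I x + M))) ∧
          ((μ y).I x + M = 0 →
            (∃ p ∈ RobustCond.labelledDistributions μ, 0 < RobustCond.prob p {ω | ω.1 = x}) →
            IsLeast (RobustCond.condProbValues (RobustCond.labelledDistributions μ)
              {ω | ω.2 = y} {ω | ω.1 = x}) 1)) := by

  have := hG.1.nonempty
  refine ⟨fun μ hμ H x => ?_, fun L _ μ hμ x y => ?_⟩
  · obtain ⟨q, hq, hqx, hmax⟩ := RobustCond.PairMarginals.exists_common_optimum hG
      (hμ.mono fun p hp => ⟨hp.1.1, hp.2⟩) Hᶜ x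
    have hdiff : RobustCond.agreeOn Hᶜ x \ RobustCond.agreeOn H x =
        RobustCond.agreeOn Hᶜ x \ {x} := by
      rw [← RobustCond.agreeOn_inter_agreeOn_compl H x, Set.inter_comm, Set.sdiff_self_inter]
    have hI : RobustCond.prob q (RobustCond.agreeOn H x ∩ RobustCond.agreeOn Hᶜ x) = μ.I x := by
      rw [RobustCond.agreeOn_inter_agreeOn_compl, RobustCond.prob_singleton, hqx]
    rw [← hI]
    refine RobustCond.isLeast_condProbValues_of_common_optimum (fun p hp => hp.1.1)
      (RobustCond.PairMarginals.mem_distributions_of_mem_measures hμ hq) (fun r hr => ?_)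
      fun r hr => ?_
    · rw [hI, RobustCond.agreeOn_inter_agreeOn_compl, RobustCond.prob_singleton]
      exact RobustCond.PairMarginals.I_le hG ⟨hr.1.1, hr.2⟩ x
    · rw [hdiff]
      exact hmax r ⟨hr.1.1, hr.2⟩
  · classical
    obtain ⟨p, hp, hmax⟩ := (RobustCond.isCompact_labelledDistributions μ).exists_isMaxOn hμ
      (RobustCond.continuous_prob ({ω | ω.1 = x} \ {ω | ω.2 = y})).continuousOn
    have hslice : ∀ r ∈ RobustCond.labelledDistributions μ,
        (fun z => r (z, y)) ∈ (μ y).measures := fun r hr => ⟨fun z => hr.1.1 _, hr.2 y⟩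
    -- Only the minimum at `x` matters in the slice `y`, so the choice of `F` is immaterial; the
    -- maximum involves only the other slices.
    obtain ⟨q, hq, hqx, -⟩ := RobustCond.PairMarginals.exists_common_optimum hG
      ⟨_, hslice p hp⟩ ∅ x
    have hinter : ({ω | ω.2 = y} ∩ {ω | ω.1 = x} : Set (((i : V) → S i) × L)) = {(x, y)} := by
      ext ω
      simp [Prod.ext_iff, and_comm]
    set p' : ((i : V) → S i) × L → ℝ := fun ω => if ω.2 = y then q ω.1 else p ω with hp'
    have hI : RobustCond.prob p' ({ω | ω.2 = y} ∩ {ω | ω.1 = x}) = (μ y).I x := by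
      rw [hinter, RobustCond.prob_singleton, ← hqx]
      exact if_pos rfl
    rw [← hI]
    refine RobustCond.isLeast_condProbValues_of_common_optimum (fun p hp => hp.1.1)
      (RobustCond.update_slice_mem_labelledDistributions hp hq) (fun r hr => ?_) fun r hr => ?_
    · rw [hI, hinter, RobustCond.prob_singleton]
      exact RobustCond.PairMarginals.I_le hG (hslice r hr) x
    · refine (hmax hr).trans_eq (Finset.sum_congr rfl fun ω _ => ?_)
      by_cases hω : ω.2 = y <;> simp [Set.indicator_apply, hω, hp']
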